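/- **Lemma (Regularity).** Let $n\in\mathbb N$, $0<T<\infty$, $I=(0,T)$, and let $\Omega^{in}\subseteq\Omega^{out}\subseteq\Omega\subseteq\mathbb R^n$ be open sets. Let $\alpha\in L^\infty(I\times\Omega)^{n\times n}$ satisfy, with constants $0<\alpha_0<\alpha_1<\infty$, $\alpha_0|v|^2\le v^{T}\alpha(t,x)v\le\alpha_1|v|^2$ for all $v\in\mathbb R^n$ and almost every $(t,x)\in I\times\Omega$. For $D\in\{\Omega^{in},\Omega^{out}\}$ let $H^1_0(D)$ be the closure of $C_c^\infty(D)$ in $H^1(D)$ and $H^{-1}(D)$ its dual space; $L^2(D)$ is mapped to $H^{-1}(D)$ by $u\mapsto(u,\cdot)_{L^2(D)}$. Let $\mathcal H(D)$ be the set of all $w\in L^\infty(I,L^2(D))\cap L^2(I,H^1(D))$ such that $$-\int_I (w(t),v)_{L^2(D)}\,\varphi_t(t)\,dt+\int_I(\alpha(t)\nabla w(t),\nabla v)_{L^2(D)}\,\varphi(t)\,dt=0\qquad\forall\,v\in H^1_0(D),\ \varphi\in C_c^\infty(I),$$ and $w(0)=0$ in $L^2(D)$, in the sense that $(w(t),v)_{L^2(D)}\to0$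 as $t\downarrow0$ outside a null set, for every $v\in L^2(D)$. Put $\mathcal H^{in}=\mathcal H(\Omega^{in})$ and $\mathcal H^{out}=\mathcal H(\Omega^{out})$. Further let $$W^{1,2,2}(I,H^1(D),H^{-1}(D))=\{u\in L^2(I,H^1(D)) : u_t\in L^2(I,H^{-1}(D))\},$$ where $u_t$ is the weak time derivative: $\int_I\varphi_t\,u\,dt=-\int_I\varphi\,u_t\,dt$ in $H^{-1}(D)$ for all $\varphi\in C_c^\infty(I)$. Then $$\mathcal H^{in}\subseteq W^{1,2,2}(I,H^1(\Omega^{in}),H^{-1}(\Omega^{in})),\qquad \mathcal H^{out}\subseteq W^{1,2,2}(I,H^1(\Omega^{out}),H^{-1}(\Omega^{out})).$$ Moreover, for $D\in\{\Omega^{in},\Omega^{out}\}$ and every $w\in\mathcal H(D)$, there is $A_\alpha w\in L^2(I,H^{-1}(D))$ with $\langle (A_\alpha w)(t),v\rangle=\int_D\alpha(t)\nabla w(t)\cdot\nabla v$ for almost every $t\in I$ and all $v\in H^1_0(D)$, and $w_t+A_\alpha w=0$ in $L^2(I,H^{-1}(D))$. -/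

import Mathlib

open MeasureTheory Filter Set Topology TopologicalSpace
open scoped ENNReal ContDiff Distributions

noncomputable section

namespace ParabolicReg

/-- Euclidean space `ℝⁿ`. -/
abbrev E (n : ℕ) : Type := EuclideanSpace ℝ (Fin n)

/-! ### Lebesgue and Sobolev spaces on an open set `D ⊆ ℝⁿ` -/

/-- `L²(D)`. -/
abbrev L2 {n : ℕ} (D : Opens (E n)) : Type := Lp ℝ 2 (volume.restrict (D : Set (E n)))

/-- `L²(D)ⁿ`. -/
abbrev L2vec {n : ℕ} (D : Opens (E n)) : Type := Lp (E n) 2 (volume.restrict (D : Set (E n)))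

/-- `g` is the weak gradient of `u` in `D`: `∫_D u ∂_e φ = - ∫_D (g · e) φ` for all test functions
`φ ∈ C_c^∞(D)` and all directions `e`. -/
def IsWeakGradient {n : ℕ} {D : Opens (E n)} (u : L2 D) (g : L2vec D) : Prop :=
  ∀ (φ : 𝓓(D, ℝ)) (e : E n),
    ∫ x in (D : Set (E n)), u x * fderiv ℝ φ x e = -∫ x in (D : Set (E n)), inner ℝ (g x) e * φ x

theorem memLp_test {n : ℕ} {D : Opens (E n)} (φ : 𝓓(D, ℝ)) :
    MemLp φ 2 (volume.restrict (D : Set (E n))) :=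
  (φ.continuous.memLp_of_hasCompactSupport φ.hasCompactSupport).restrict _

theorem memLp_fderiv_test {n : ℕ} {D : Opens (E n)} (φ : 𝓓(D, ℝ)) (e : E n) :
    MemLp (fun x => fderiv ℝ φ x e) 2 (volume.restrict (D : Set (E n))) := by
  have hc : Continuous (fun x => fderiv ℝ φ x e) :=
    (φ.contDiff.continuous_fderiv (by simp)).clm_apply continuous_const
  have hs : HasCompactSupport (fun x => fderiv ℝ φ x e) := φ.hasCompactSupport.fderiv_apply ℝ e
  exact (hc.memLp_of_hasCompactSupport hs).restrict _

theorem integrable_left {n : ℕ} {D : Opens (E n)} (u : L2 D) (φ : 𝓓(D, ℝ)) (e : E n) :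
    Integrable (fun x => u x * fderiv ℝ φ x e) (volume.restrict (D : Set (E n))) :=
  (Lp.memLp u).integrable_mul (memLp_fderiv_test φ e)

theorem integrable_right {n : ℕ} {D : Opens (E n)} (g : L2vec D) (φ : 𝓓(D, ℝ)) (e : E n) :
    Integrable (fun x => inner ℝ (g x) e * φ x) (volume.restrict (D : Set (E n))) :=
  ((Lp.memLp g).inner_const e).integrable_mul (memLp_test φ)

theorem IsWeakGradient.zero {n : ℕ} {D : Opens (E n)} :
    IsWeakGradient (0 : L2 D) (0 : L2vec D) := by
  intro φ e
  have h1 : ∫ x in (D : Set (E n)), (0 : L2 D) x * fderiv ℝ φ x e = 0 := by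
    apply integral_eq_zero_of_ae
    filter_upwards [Lp.coeFn_zero ℝ 2 (volume.restrict (D : Set (E n)))] with x hx
    rw [hx]; simp
  have h2 : ∫ x in (D : Set (E n)), inner ℝ ((0 : L2vec D) x) e * φ x = 0 := by
    apply integral_eq_zero_of_ae
    filter_upwards [Lp.coeFn_zero (E n) 2 (volume.restrict (D : Set (E n)))] with x hx
    rw [hx]; simp
  rw [h1, h2, neg_zero]

theorem IsWeakGradient.add {n : ℕ} {D : Opens (E n)} {u u' : L2 D} {g g' : L2vec D}
    (h : IsWeakGradient u g) (h' : IsWeakGradient u' g') : IsWeakGradient (u + u') (g + g') := by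
  intro φ e
  have h1 : ∫ x in (D : Set (E n)), (u + u') x * fderiv ℝ φ x e =
      ∫ x in (D : Set (E n)), (u x * fderiv ℝ φ x e + u' x * fderiv ℝ φ x e) := by
    apply integral_congr_ae
    filter_upwards [Lp.coeFn_add u u'] with x hx
    rw [hx, Pi.add_apply, add_mul]
  have h2 : ∫ x in (D : Set (E n)), inner ℝ ((g + g') x) e * φ x =
      ∫ x in (D : Set (E n)), (inner ℝ (g x) e * φ x + inner ℝ (g' x) e * φ x) := by
    apply integral_congr_ae
    filter_upwards [Lp.coeFn_add g g'] with x hx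
    rw [hx, Pi.add_apply, inner_add_left, add_mul]
  rw [h1, h2, integral_add (integrable_left u φ e) (integrable_left u' φ e),
    integral_add (integrable_right g φ e) (integrable_right g' φ e), h φ e, h' φ e]
  ring

theorem IsWeakGradient.smul {n : ℕ} {D : Opens (E n)} {u : L2 D} {g : L2vec D} (c : ℝ)
    (h : IsWeakGradient u g) : IsWeakGradient (c • u) (c • g) := by
  intro φ e
  have h1 : ∫ x in (D : Set (E n)), (c • u) x * fderiv ℝ φ x e =
      ∫ x in (D : Set (E n)), c * (u x * fderiv ℝ φ x e) := by
    apply integral_congr_ae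
    filter_upwards [Lp.coeFn_smul c u] with x hx
    simp [hx, mul_assoc]
  have h2 : ∫ x in (D : Set (E n)), inner ℝ ((c • g) x) e * φ x =
      ∫ x in (D : Set (E n)), c * (inner ℝ (g x) e * φ x) := by
    apply integral_congr_ae
    filter_upwards [Lp.coeFn_smul c g] with x hx
    simp [hx, mul_assoc, real_inner_smul_left]
  rw [h1, h2, integral_const_mul, integral_const_mul, h φ e]
  ring

/-- The graph of the weak gradient, with the norm `(‖u‖² + ‖∇u‖²)^(1/2)` of the `ℓ²`-product. -/
def weakGradientGraph {n : ℕ} (D : Opens (E n)) : Submodule ℝ (WithLp 2 (L2 D × L2vec D)) where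
  carrier := {p | IsWeakGradient p.fst p.snd}
  zero_mem' := IsWeakGradient.zero
  add_mem' := fun h h' => IsWeakGradient.add h h'
  smul_mem' := fun c _ h => IsWeakGradient.smul c h

/-- The Sobolev space `H¹(D)`, its elements being pairs `(u, ∇u)`. -/
def H1 {n : ℕ} (D : Opens (E n)) : Type := weakGradientGraph D

instance {n : ℕ} (D : Opens (E n)) : NormedAddCommGroup (H1 D) :=
  inferInstanceAs (NormedAddCommGroup (weakGradientGraph D))

instance {n : ℕ} (D : Opens (E n)) : InnerProductSpace ℝ (H1 D) :=
  inferInstanceAs (InnerProductSpace ℝ (weakGradientGraph D))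

/-- The inclusion of `H¹(D)` in `L²(D) × L²(D)ⁿ`, `u ↦ (u, ∇u)`. -/
def H1.toProd {n : ℕ} (D : Opens (E n)) : H1 D →ₗᵢ[ℝ] WithLp 2 (L2 D × L2vec D) :=
  (weakGradientGraph D).subtypeₗᵢ

/-- The inclusion `H¹(D) → L²(D)`. -/
def H1.toL2 {n : ℕ} (D : Opens (E n)) : H1 D →L[ℝ] L2 D :=
  (WithLp.fstL 2 ℝ (L2 D) (L2vec D)).comp (H1.toProd D).toContinuousLinearMap

/-- The weak gradient `∇ : H¹(D) → L²(D)ⁿ`. -/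
def H1.grad {n : ℕ} (D : Opens (E n)) : H1 D →L[ℝ] L2vec D :=
  (WithLp.sndL 2 ℝ (L2 D) (L2vec D)).comp (H1.toProd D).toContinuousLinearMap

/-- `H¹₀(D)`, the closure of `C_c^∞(D)` in `H¹(D)`. -/
def H10 {n : ℕ} (D : Opens (E n)) : Submodule ℝ (H1 D) :=
  (Submodule.span ℝ {v : H1 D | ∃ φ : 𝓓(D, ℝ),
    H1.toL2 D v =ᵐ[volume.restrict (D : Set (E n))] φ}).topologicalClosure

/-- `H⁻¹(D)`, the dual of `H¹₀(D)` with the operator norm. -/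
abbrev Hm1 {n : ℕ} (D : Opens (E n)) : Type := H10 D →L[ℝ] ℝ

/-- The inclusion `H¹₀(D) → L²(D)`. -/
def H10.toL2 {n : ℕ} (D : Opens (E n)) : H10 D →L[ℝ] L2 D :=
  (H1.toL2 D).comp (H10 D).subtypeL

/-- The map `L²(D) → H⁻¹(D)`, `u ↦ (v ↦ (u, v)_{L²(D)})`. -/
def L2toHm1 {n : ℕ} (D : Opens (E n)) : L2 D →L[ℝ] Hm1 D :=
  ((ContinuousLinearMap.compL ℝ (H10 D) (L2 D) ℝ).flip (H10.toL2 D)).comp (innerSL ℝ)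

theorem L2toHm1_apply {n : ℕ} (D : Opens (E n)) (u : L2 D) (v : H10 D) :
    L2toHm1 D u v = inner ℝ u (H10.toL2 D v) := rfl

/-- The map `H¹(D) → L²(D) → H⁻¹(D)`. -/
def H1.toHm1 {n : ℕ} (D : Opens (E n)) : H1 D →L[ℝ] Hm1 D := (L2toHm1 D).comp (H1.toL2 D)

/-! ### Bochner spaces on the time interval `I = (0,T)` -/

/-- The time interval `I = (0,T)`. -/
def timeI (T : ℝ) : Opens ℝ := ⟨Ioo 0 T, isOpen_Ioo⟩

/-- Lebesgue measure on `I = (0,T)`. -/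
abbrev volI (T : ℝ) : Measure ℝ := volume.restrict (timeI T : Set ℝ)

/-- The Bochner space `L²(I, X)`. -/
abbrev L2I (T : ℝ) (X : Type) [NormedAddCommGroup X] : Type := Lp X 2 (volI T)

/-- `g ∈ L²(I, Y)` is the weak time derivative `u_t` of `u ∈ L²(I, X)`, where `X` is mapped to `Y`
by `j`: `∫_I φ_t(t) j(u(t)) dt = - ∫_I φ(t) g(t) dt` in `Y` for all `φ ∈ C_c^∞(I)`. -/
def IsWeakTimeDeriv {T : ℝ} {X Y : Type} [NormedAddCommGroup X] [NormedSpace ℝ X]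
    [NormedAddCommGroup Y] [NormedSpace ℝ Y] (j : X →L[ℝ] Y) (u : L2I T X) (g : L2I T Y) : Prop :=
  ∀ φ : 𝓓(timeI T, ℝ),
    ∫ t in (timeI T : Set ℝ), deriv φ t • j (u t) = -∫ t in (timeI T : Set ℝ), φ t • g t

/-- `W^{1,2,2}(I, X, Y) = {u ∈ L²(I, X) | u_t ∈ L²(I, Y)}`, where `X` is mapped to `Y` by `j`. -/
def W122 (T : ℝ) (X Y : Type) [NormedAddCommGroup X] [NormedSpace ℝ X]
    [NormedAddCommGroup Y] [NormedSpace ℝ Y] (j : X →L[ℝ] Y) : Set (L2I T X) :=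
  {u | ∃ g : L2I T Y, IsWeakTimeDeriv j u g}

/-! ### The heat equation -/

/-- A heat conductivity coefficient on `I × Ω`: `α ∈ L^∞(I × Ω)^{n×n}`, uniformly elliptic and
bounded, `α₀ |v|² ≤ vᵀ α(t,x) v ≤ α₁ |v|²` for a.e. `(t,x)` and all `v`. -/
structure IsConductivity {n : ℕ} (T : ℝ) (Ω : Opens (E n))
    (α : ℝ → E n → Matrix (Fin n) (Fin n) ℝ) : Prop where
  memLp_top : ∀ i j, MemLp (fun p : ℝ × E n => α p.1 p.2 i j) ∞
    ((volI T).prod (volume.restrict (Ω : Set (E n))))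
  elliptic : ∃ α₀ α₁ : ℝ, 0 < α₀ ∧ α₀ < α₁ ∧
    ∀ᵐ p : ℝ × E n ∂((volI T).prod (volume.restrict (Ω : Set (E n)))), ∀ v : E n,
      α₀ * ‖v‖ ^ 2 ≤ v.ofLp ⬝ᵥ (α p.1 p.2).mulVec v.ofLp ∧
      v.ofLp ⬝ᵥ (α p.1 p.2).mulVec v.ofLp ≤ α₁ * ‖v‖ ^ 2

/-- `∫_D a ∇w · ∇v` for a matrix field `a` on `D`. -/
def dirichletForm {n : ℕ} (D : Opens (E n)) (a : E n → Matrix (Fin n) (Fin n) ℝ) (w v : H1 D) : ℝ :=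
  ∫ x in (D : Set (E n)), (a x).mulVec (H1.grad D w x).ofLp ⬝ᵥ (H1.grad D v x).ofLp

/-- `F ∈ L²(I, H⁻¹(D))` is `A_α w`, that is, for a.e. `t ∈ I`,
`⟨F(t), v⟩ = ∫_D α(t,·) ∇w(t) · ∇v` for all `v ∈ H¹₀(D)`. -/
def IsAOp {n : ℕ} {T : ℝ} {D : Opens (E n)} (α : ℝ → E n → Matrix (Fin n) (Fin n) ℝ)
    (w : L2I T (H1 D)) (F : L2I T (Hm1 D)) : Prop :=
  ∀ᵐ t ∂(volI T), ∀ v : H10 D, F t v = dirichletForm D (α t) (w t) v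

/-- `w(0) = u₀` in `L²(D)`: the essential limit of `w(t)` as `t ↓ 0`, in the weak topology of
`L²(D)`, is `u₀`. -/
def HasInitialValue {n : ℕ} {T : ℝ} {D : Opens (E n)} (w : L2I T (H1 D)) (u₀ : L2 D) : Prop :=
  ∀ v : L2 D, Tendsto (fun t => inner ℝ (H1.toL2 D (w t)) v) (𝓝[>] 0 ⊓ ae volume) (𝓝 (inner ℝ u₀ v))

/-- `w ∈ L^∞(I, L²(D)) ∩ L²(I, H¹(D))` solves the local problem on `I × D` with source
`f ∈ L²(I, H⁻¹(D))` and initial value `u₀`, without boundary conditions on `I × ∂D`. -/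
structure SolvesLocal {n : ℕ} {T : ℝ} {D : Opens (E n)}
    (α : ℝ → E n → Matrix (Fin n) (Fin n) ℝ) (f : L2I T (Hm1 D)) (u₀ : L2 D)
    (w : L2I T (H1 D)) : Prop where
  memLp_top : MemLp (fun t => H1.toL2 D (w t)) ∞ (volI T)
  weak_eq : ∀ (v : H10 D) (φ : 𝓓(timeI T, ℝ)),
    -(∫ t in (timeI T : Set ℝ), inner ℝ (H1.toL2 D (w t)) (H10.toL2 D v) * deriv φ t) +
        ∫ t in (timeI T : Set ℝ), dirichletForm D (α t) (w t) v * φ t =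
      ∫ t in (timeI T : Set ℝ), f t v * φ t
  initial : HasInitialValue w u₀

/-- The space of weak local solutions on `I × D` with `f = 0` and `u₀ = 0`. -/
def localSolutions {n : ℕ} (T : ℝ) (D : Opens (E n))
    (α : ℝ → E n → Matrix (Fin n) (Fin n) ℝ) : Set (L2I T (H1 D)) :=
  {w | SolvesLocal α 0 0 w}

end ParabolicReg

end

/-! ### Strong measurability of Hilbert space valued maps -/

/-! For each fixed `v`, the weak equation already says that the scalar function `(w(t), v)` has weak
derivative `-(α(t)∇w(t), ∇v)`. What remains is to realise the right-hand sides, for all `v` at once,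
by a single element of `L²(I, H⁻¹(D))`; the vector-valued identity then follows by evaluating
Bochner integrals at each `v`.

The functional factors through the `L²(D)ⁿ`-valued map `t ↦ α(t)∇w(t)`. Its norm is at most the
essential supremum of `α` times `‖∇w(t)‖`, so only strong measurability in `t` is delicate. For a
frozen field `u`, the pairings `(h, α(t)u)` are measurable by Fubini, and Pettis' theorem in the
separable space `L²` upgrades this to strong measurability of `α(t)u`. Approximation by simple
functions then replaces `u` by `∇w(t)`. -/

/-- A Hilbert basis of a separable space is countable. -/
theorem HilbertBasis.countable_of_separableSpace {ι H : Type*} [NormedAddCommGroup H]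
    [InnerProductSpace ℝ H] [SeparableSpace H] (b : HilbertBasis ι ℝ H) : Countable ι := by
  have hb := b.orthonormal
  -- The distance is in fact `√2`; the bound `1` suffices to make the balls of radius `1/2`
  -- disjoint.
  have hd : ∀ i j, i ≠ j → 1 ≤ dist (b i) (b j) := by
    intro i j hij
    have h := norm_sub_sq_real (b i) (b j)
    rw [hb.1 i, hb.1 j, hb.2 hij] at h
    rw [dist_eq_norm]
    nlinarith [norm_nonneg (b i - b j)]
  refine Pairwise.countable_of_isOpen_disjoint (s := fun i => Metric.ball (b i) (1 / 2)) ?_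
    (fun i => Metric.isOpen_ball) (fun i => ⟨b i, Metric.mem_ball_self (by norm_num)⟩)
  intro i j hij
  exact Metric.ball_disjoint_ball (by linarith [hd i j hij])

/-- Pettis' theorem in a separable Hilbert space. -/
theorem aestronglyMeasurable_of_forall_inner {ι H : Type*} [MeasurableSpace ι] {μ : Measure ι}
    [NormedAddCommGroup H] [InnerProductSpace ℝ H] [CompleteSpace H] [SeparableSpace H]
    {f : ι → H} (hf : ∀ h : H, AEStronglyMeasurable (fun t => inner ℝ h (f t)) μ) :
    AEStronglyMeasurable f μ := by
  obtain ⟨w, b, -⟩ := exists_hilbertBasis ℝ H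
  have : Countable w := b.countable_of_separableSpace
  -- Countability of `w` makes `atTop` on `Finset w` countably generated, so limits of the partial
  -- sums of the expansion stay measurable.
  refine aestronglyMeasurable_of_tendsto_ae (u := (atTop : Filter (Finset w)))
    (f := fun s t => ∑ i ∈ s, inner ℝ (b i) (f t) • b i) (fun s => ?_) (ae_of_all _ fun t => ?_)
  · exact Finset.aestronglyMeasurable_fun_sum s fun i _ => (hf (b i)).smul_const (b i)
  · have h := b.hasSum_repr (f t)
    simp only [b.repr_apply_apply] at h
    exact h

/-- If `M t` is a family of bounded operators such that `t ↦ M t u` is a.e. strongly measurable for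
every `u`, then `t ↦ M t (g t)` is a.e. strongly measurable for every such `g`. -/
theorem aestronglyMeasurable_clm_apply_of_forall {ι X Y : Type*} [MeasurableSpace ι]
    {μ : Measure ι} [NormedAddCommGroup X] [NormedSpace ℝ X] [NormedAddCommGroup Y]
    [NormedSpace ℝ Y] {M : ι → X →L[ℝ] Y} (hM : ∀ u, AEStronglyMeasurable (fun t => M t u) μ)
    {g : ι → X} (hg : AEStronglyMeasurable g μ) :
    AEStronglyMeasurable (fun t => M t (g t)) μ := by
  have key : ∀ f : ι → X, StronglyMeasurable f →
      AEStronglyMeasurable (fun t => M t (f t)) μ := by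
    intro f hf
    induction f, hf using StronglyMeasurable.induction with
    | ind c hs =>
      refine ((hM c).indicator hs).congr (ae_of_all _ fun t => ?_)
      simp only [indicator]
      split_ifs <;> simp
    | add hf hg _ _ h₁ h₂ =>
      simpa only [Pi.add_apply, map_add] using! h₁.add h₂
    | lim hf hg h₁ h₂ =>
      exact aestronglyMeasurable_of_tendsto_ae atTop h₁
        (ae_of_all _ fun t => ((M t).continuous.tendsto _).comp (h₂ t))
  refine (key _ hg.stronglyMeasurable_mk).congr ?_
  filter_upwards [hg.ae_eq_mk] with t ht
  rw [ht]

/-! ### Multiplication by a bounded operator field -/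

/-- Pointwise application of a field of operators `a ∈ L^∞(I × X)` maps an `L²(X)`-valued strongly
measurable function to another one, with a norm bound. -/
theorem exists_aestronglyMeasurable_mul {ι X V W : Type*} [MeasurableSpace ι] [MeasurableSpace X]
    {μ : Measure ι} {ν : Measure X} [SFinite ν] [IsSeparable ν]
    [NormedAddCommGroup V] [NormedSpace ℝ V]
    [NormedAddCommGroup W] [InnerProductSpace ℝ W] [CompleteSpace W] [SeparableSpace W]
    {a : ι → X → V →L[ℝ] W} (ha : MemLp (fun p : ι × X => a p.1 p.2) ⊤ (μ.prod ν))
    {g : ι → Lp V 2 ν} (hg : AEStronglyMeasurable g μ) :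
    ∃ (C : ℝ) (G : ι → Lp W 2 ν), AEStronglyMeasurable G μ ∧
      ∀ᵐ t ∂μ, ‖G t‖ ≤ C * ‖g t‖ ∧ G t =ᵐ[ν] fun x => a t x (g t x) := by
  classical
  -- A finite exponent and `IsSeparable ν` make `Lp W 2 ν` separable, as Pettis' theorem requires.
  have : Fact ((2 : ℝ≥0∞) ≠ ⊤) := ⟨ENNReal.ofNat_ne_top⟩
  set C : ℝ := (eLpNormEssSup (fun p : ι × X => a p.1 p.2) (μ.prod ν)).toReal with hC
  have hfin : eLpNormEssSup (fun p : ι × X => a p.1 p.2) (μ.prod ν) ≠ ⊤ := by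
    simpa using ha.2.ne
  have hbd : ∀ᵐ t ∂μ, ∀ᵐ x ∂ν, ‖a t x‖ ≤ C := by
    refine Measure.ae_ae_of_ae_prod (p := fun p : ι × X => ‖a p.1 p.2‖ ≤ C) ?_
    filter_upwards [enorm_ae_le_eLpNormEssSup (fun p : ι × X => a p.1 p.2) (μ.prod ν)] with p hp
    have := ENNReal.toReal_mono hfin hp
    rwa [toReal_enorm] at this
  have hmem : ∀ᵐ t ∂μ, MemLp (a t) ⊤ ν := by
    filter_upwards [ha.1.prodMk_left, hbd] with t h₁ h₂
    exact memLp_top_of_bound h₁ C h₂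
  -- The value `0` is taken only on a null set of times; it makes `M t`, the Hölder product `L^∞ ×
  -- L² → L²` with `A t`, an operator for every `t`.
  let A : ι → Lp (V →L[ℝ] W) ⊤ ν := fun t => if h : MemLp (a t) ⊤ ν then h.toLp _ else 0
  let B := (ContinuousLinearMap.id ℝ (V →L[ℝ] W))
  let M : ι → Lp V 2 ν →L[ℝ] Lp W 2 ν := fun t => B.holderL ν ⊤ 2 2 (A t)
  have hM : ∀ᵐ t ∂μ, ∀ u : Lp V 2 ν, M t u =ᵐ[ν] fun x => a t x (u x) := by
    filter_upwards [hmem] with t ht u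
    have hA : A t =ᵐ[ν] a t := by
      simp only [A, ht, dif_pos]
      exact ht.coeFn_toLp
    have h := B.coeFn_holder (r := 2) (A t) u
    filter_upwards [h, hA] with x h₁ h₂
    rw [← h₂]
    exact h₁
  have hMm : ∀ u, AEStronglyMeasurable (fun t => M t u) μ := by
    intro u
    refine aestronglyMeasurable_of_forall_inner fun h => ?_
    have hm : AEStronglyMeasurable (fun p : ι × X => inner ℝ (h p.2) (a p.1 p.2 (u p.2)))
        (μ.prod ν) := by
      have h₁ : AEStronglyMeasurable (fun p : ι × X => h p.2) (μ.prod ν) :=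
        (Lp.aestronglyMeasurable h).comp_snd
      have h₂ : AEStronglyMeasurable (fun p : ι × X => u p.2) (μ.prod ν) :=
        (Lp.aestronglyMeasurable u).comp_snd
      exact h₁.inner (B.aestronglyMeasurable_comp₂ ha.1 h₂)
    refine hm.integral_prod_right'.congr ?_
    filter_upwards [hM] with t ht
    rw [L2.inner_def]
    refine integral_congr_ae ?_
    filter_upwards [ht u] with x hx
    rw [hx]
  refine ⟨C, fun t => M t (g t), aestronglyMeasurable_clm_apply_of_forall hMm hg, ?_⟩
  filter_upwards [hM, hbd] with t h₁ h₂
  refine ⟨Lp.norm_le_mul_norm_of_ae_le_mul ?_, h₁ _⟩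
  filter_upwards [h₁ (g t), h₂] with x hx hx'
  rw [hx]
  exact ((a t x).le_opNorm _).trans (by gcongr)

theorem memLp_sum_smul_const {κ X Y : Type*} [Fintype κ] [MeasurableSpace X] {μ : Measure X}
    [NormedAddCommGroup Y] [NormedSpace ℝ Y] {p : ℝ≥0∞} {f : κ → X → ℝ}
    (hf : ∀ k, MemLp (f k) p μ) (c : κ → Y) : MemLp (fun x => ∑ k, f k x • c k) p μ :=
  memLp_finsetSum _ fun k _ => (ContinuousLinearMap.toSpanSingleton ℝ (c k)).comp_memLp' (hf k)

/-- A finite combination of fixed operators with `L^∞` coefficients is an `L^∞` operator field. -/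
theorem memLp_sum_smul_clm {κ X V W : Type*} [Fintype κ] [MeasurableSpace X] {μ : Measure X}
    [NormedAddCommGroup V] [NormedSpace ℝ V] [NormedAddCommGroup W] [NormedSpace ℝ W] {p : ℝ≥0∞}
    {f : κ → X → ℝ} (hf : ∀ k, MemLp (f k) p μ) (c : κ → V →L[ℝ] W) :
    MemLp (fun x => ∑ k, f k x • c k) p μ :=
  memLp_sum_smul_const (Y := V →L[ℝ] W) hf c

/-! ### Bochner spaces with values in a dual space -/

theorem exists_Lp_dual_comp {ι X H : Type*} [MeasurableSpace ι] {μ : Measure ι}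
    [NormedAddCommGroup X] [NormedSpace ℝ X] [NormedAddCommGroup H] [NormedSpace ℝ H]
    (L : X →L[ℝ] (H →L[ℝ] ℝ)) {p : ℝ≥0∞} {f : ι → X} (hf : MemLp f p μ) :
    ∃ F : Lp (H →L[ℝ] ℝ) p μ, F =ᵐ[μ] fun t => L (f t) :=
  ⟨(L.comp_memLp' hf).toLp _, (L.comp_memLp' hf).coeFn_toLp⟩

/-- An identity of integrals in a dual space can be tested pointwise. -/
theorem integral_smul_dual_eq_neg {ι X H : Type*} [MeasurableSpace ι] {μ : Measure ι}
    [NormedAddCommGroup X] [NormedSpace ℝ X] [NormedAddCommGroup H] [NormedSpace ℝ H]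
    (j : X →L[ℝ] (H →L[ℝ] ℝ)) (w : Lp X 2 μ) (F : Lp (H →L[ℝ] ℝ) 2 μ) {ψ φ : ι → ℝ}
    (hψ : MemLp ψ 2 μ) (hφ : MemLp φ 2 μ)
    (h : ∀ v : H, ∫ t, j (w t) v * ψ t ∂μ = -∫ t, F t v * φ t ∂μ) :
    ∫ t, ψ t • j (w t) ∂μ = -∫ t, φ t • F t ∂μ := by
  have hj : MemLp (fun t => j (w t)) 2 μ := j.comp_memLp' (Lp.memLp w)
  have hi₁ : Integrable (fun t => ψ t • j (w t)) μ := memLp_one_iff_integrable.1 (hj.smul hψ)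
  have hi₂ : Integrable (fun t => φ t • F t) μ := memLp_one_iff_integrable.1 ((Lp.memLp F).smul hφ)
  ext v
  rw [_root_.neg_apply, ContinuousLinearMap.integral_apply hi₁,
    ContinuousLinearMap.integral_apply hi₂]
  simpa [mul_comm] using h v

namespace ParabolicReg

/-! ### The operator `A_α` -/

/-- The map `L²(D)ⁿ → H⁻¹(D)`, `g ↦ (v ↦ (g, ∇v)_{L²(D)})`. -/
noncomputable def L2vecToHm1 {n : ℕ} (D : Opens (E n)) : L2vec D →L[ℝ] Hm1 D :=
  ((ContinuousLinearMap.compL ℝ (H10 D) (L2vec D) ℝ).flip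
    ((H1.grad D).comp (H10 D).subtypeL)).comp (innerSL ℝ)

theorem L2vecToHm1_apply {n : ℕ} (D : Opens (E n)) (g : L2vec D) (v : H10 D) :
    L2vecToHm1 D g v = inner ℝ g (H1.grad D v) := rfl

/-- Expanding `A x` in the matrix units gives a finite sum of fixed operators whose coefficients are
the entries. -/
theorem memLp_top_toEuclideanCLM {n : ℕ} {X : Type*} [MeasurableSpace X] {μ : Measure X}
    {A : X → Matrix (Fin n) (Fin n) ℝ} (hA : ∀ i j, MemLp (fun x => A x i j) ⊤ μ) :
    MemLp (fun x => Matrix.toEuclideanCLM (n := Fin n) (𝕜 := ℝ) (A x)) ⊤ μ := by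
  have h := memLp_sum_smul_clm (fun k : Fin n × Fin n => hA k.1 k.2) fun k =>
    Matrix.toEuclideanCLM (n := Fin n) (𝕜 := ℝ) (Matrix.single k.1 k.2 1)
  refine (memLp_congr_ae (ae_of_all _ fun x => ?_)).1 h
  conv_rhs => rw [Matrix.matrix_eq_sum_single (A x)]
  simp only [map_sum, ← map_smul, Matrix.smul_single, smul_eq_mul, mul_one,
    Fintype.sum_prod_type]

/-- `A_α w` exists in `L²(I, H⁻¹(D))`. -/
theorem exists_isAOp {n : ℕ} {T : ℝ} {Ω D : Opens (E n)} (hD : D ≤ Ω)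
    {α : ℝ → E n → Matrix (Fin n) (Fin n) ℝ} (hα : IsConductivity T Ω α) (w : L2I T (H1 D)) :
    ∃ F : L2I T (Hm1 D), IsAOp α w F := by
  -- The bounds on `α` are given on `I × Ω`; absolute continuity carries measurability and the
  -- essential supremum bound to `I × D`.
  have hac : ((volI T).prod (volume.restrict (D : Set (E n)))) ≪
      ((volI T).prod (volume.restrict (Ω : Set (E n)))) :=
    Measure.AbsolutelyContinuous.rfl.prod
      (Measure.absolutelyContinuous_of_le (Measure.restrict_mono hD le_rfl))
  have ha := memLp_top_toEuclideanCLM (A := fun p : ℝ × E n => α p.1 p.2)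
    (μ := (volI T).prod (volume.restrict (D : Set (E n)))) fun i j =>
      ⟨(hα.memLp_top i j).1.mono_ac hac, by
        have := (hα.memLp_top i j).2
        rw [eLpNorm_exponent_top] at this ⊢
        exact (eLpNormEssSup_mono_measure _ hac).trans_lt this⟩
  have hw : MemLp (fun t => H1.grad D (w t)) 2 (volI T) :=
    (H1.grad D).comp_memLp' (Lp.memLp w)
  obtain ⟨C, G, hGm, hG⟩ := exists_aestronglyMeasurable_mul
    (a := fun t x => Matrix.toEuclideanCLM (n := Fin n) (𝕜 := ℝ) (α t x)) ha hw.1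
  have hG2 : MemLp G 2 (volI T) := hw.of_le_mul hGm (hG.mono fun t ht => ht.1)
  obtain ⟨F, hF⟩ := exists_Lp_dual_comp (L2vecToHm1 D) hG2
  refine ⟨F, ?_⟩
  filter_upwards [hF, hG] with t h₁ h₂ v
  rw [h₁, L2vecToHm1_apply, L2.inner_def, dirichletForm]
  refine integral_congr_ae ?_
  filter_upwards [h₂.2] with x hx
  rw [hx, EuclideanSpace.inner_eq_star_dotProduct, dotProduct_comm]
  rfl

/-! ### Test functions in time -/

theorem memLp_deriv_test {T : ℝ} (φ : 𝓓(timeI T, ℝ)) : MemLp (deriv φ) 2 (volI T) := by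
  have hc : Continuous (deriv φ) := φ.contDiff.continuous_deriv (by simp)
  exact (hc.memLp_of_hasCompactSupport φ.hasCompactSupport.deriv).restrict _

theorem memLp_time_test {T : ℝ} (φ : 𝓓(timeI T, ℝ)) : MemLp φ 2 (volI T) :=
  (φ.continuous.memLp_of_hasCompactSupport φ.hasCompactSupport).restrict _

/-- A local solution satisfies `w_t = -A_α w`. -/
theorem SolvesLocal.isWeakTimeDeriv_neg {n : ℕ} {T : ℝ} {D : Opens (E n)}
    {α : ℝ → E n → Matrix (Fin n) (Fin n) ℝ} {u₀ : L2 D} {w : L2I T (H1 D)}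
    (hw : SolvesLocal α 0 u₀ w) {F : L2I T (Hm1 D)} (hF : IsAOp α w F) :
    IsWeakTimeDeriv (H1.toHm1 D) w (-F) := by
  intro φ
  refine integral_smul_dual_eq_neg (H1.toHm1 D) w (-F) (memLp_deriv_test φ) (memLp_time_test φ)
    fun v => ?_
  have h := hw.weak_eq v φ
  have h0 : ∫ t in (timeI T : Set ℝ), (0 : L2I T (Hm1 D)) t v * φ t = 0 := by
    refine integral_eq_zero_of_ae ?_
    filter_upwards [Lp.coeFn_zero (Hm1 D) 2 (volI T)] with t ht
    rw [ht]
    simp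
  -- With zero source, `∫ (w, v) φ' = ∫ (α∇w, ∇v) φ`; the minus sign of the weak derivative cancels
  -- that of `-F`.
  rw [h0, neg_add_eq_zero] at h
  refine h.trans ?_
  rw [← integral_neg]
  refine integral_congr_ae ?_
  filter_upwards [hF, Lp.coeFn_neg F] with t h₁ h₂
  rw [h₂, ← h₁ v]
  simp

/-- Local solutions are in `W^{1,2,2}(I, H¹(D), H⁻¹(D))` and satisfy `w_t + A_α w = 0`. -/
theorem localSolutions_regularity {n : ℕ} {T : ℝ} {Ω D : Opens (E n)} (hD : D ≤ Ω)
    {α : ℝ → E n → Matrix (Fin n) (Fin n) ℝ} (hα : IsConductivity T Ω α) :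
    localSolutions T D α ⊆ W122 T (H1 D) (Hm1 D) (H1.toHm1 D) ∧
      ∀ w ∈ localSolutions T D α, ∃ wt Aw : L2I T (Hm1 D),
        IsWeakTimeDeriv (H1.toHm1 D) w wt ∧ IsAOp α w Aw ∧ wt + Aw = 0 := by
  have key : ∀ w ∈ localSolutions T D α, ∃ wt Aw : L2I T (Hm1 D),
      IsWeakTimeDeriv (H1.toHm1 D) w wt ∧ IsAOp α w Aw ∧ wt + Aw = 0 := by
    intro w hw
    obtain ⟨F, hF⟩ := exists_isAOp hD hα w
    exact ⟨-F, F, hw.isWeakTimeDeriv_neg hF, hF, neg_add_cancel F⟩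
  refine ⟨fun w hw => ?_, key⟩
  obtain ⟨wt, -, h, -⟩ := key w hw
  exact ⟨wt, h⟩

end ParabolicReg

theorem lemma3p2 {n : ℕ} {T : ℝ} (hT : 0 < T)
    (Ω Ωin Ωout : TopologicalSpace.Opens (ParabolicReg.E n)) (hin : Ωin ≤ Ωout) (hout : Ωout ≤ Ω)
    (α : ℝ → ParabolicReg.E n → Matrix (Fin n) (Fin n) ℝ)
    (hα : ParabolicReg.IsConductivity T Ω α) :
    (ParabolicReg.localSolutions T Ωin α ⊆
      ParabolicReg.W122 T (ParabolicReg.H1 Ωin) (ParabolicReg.Hm1 Ωin) (ParabolicReg.H1.toHm1 Ωin) ∧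
      ∀ w ∈ ParabolicReg.localSolutions T Ωin α,
        ∃ wt Aw : ParabolicReg.L2I T (ParabolicReg.Hm1 Ωin),
          ParabolicReg.IsWeakTimeDeriv (ParabolicReg.H1.toHm1 Ωin) w wt ∧
          ParabolicReg.IsAOp α w Aw ∧ wt + Aw = 0) ∧
    (ParabolicReg.localSolutions T Ωout α ⊆
      ParabolicReg.W122 T (ParabolicReg.H1 Ωout) (ParabolicReg.Hm1 Ωout) (ParabolicReg.H1.toHm1 Ωout) ∧
      ∀ w ∈ ParabolicReg.localSolutions T Ωout α,
        ∃ wt Aw : ParabolicReg.L2I T (ParabolicReg.Hm1 Ωout),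
          ParabolicReg.IsWeakTimeDeriv (ParabolicReg.H1.toHm1 Ωout) w wt ∧
          ParabolicReg.IsAOp α w Aw ∧ wt + Aw = 0) :=
  ⟨ParabolicReg.localSolutions_regularity (hin.trans hout) hα,
    ParabolicReg.localSolutions_regularity hout hα⟩
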